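/- Let $n\ge 2$. An $n$-web diagram is a planar diagram of an oriented framed graph (blackboard framing, with oriented closed components allowed) all of whose vertices are $n$-valent sinks or $n$-valent sources, each with a marked point on its boundary. The edges and closed components are called bands and annuli. Diagrams are presented by decomposing them into elementary horizontal slices: positive and negative crossings of two downward strands, oriented cups and caps, sources (bands leaving downwards, marked point at the top) and sinks (bands arriving from above, marked point at the bottom). A link diagram is a web diagram without vertices; a planar web is a web diagram without crossings. *Bracket.* Let $V$ have basis $e_1,\dots,e_n$, attach $V$ to downward strands and $V^*$, with dual basis $e^1,\dots,e^n$, to upward strands. Reading from bottom to top, attach to a positive crossing the map $$\hat R(e_i\otimes e_j)=q^{-1/n}\begin{cases}e_j\otimes e_i & i>j\\ q\,e_i\otimes e_j & i=j\\ e_j\otimes e_i+(q-q^{-1})e_i\otimes e_j& i<j\end{cases}$$ and to a negative crossing $\hat R^{-1}$; to the caps $e^i\otimes e_j\mapsto\delta_{ij}$ and $e_i\otimes e^j\mapsto q^{2i-n-1}\delta_{ij}$; to the cups $1\mapsto\sum_i e_i\otimes e^i$ and $1\mapsto\sum_i q^{n+1-2i}e^i\otimes e_i$; to a sink $1\mapsto\sum_{\sigma\in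 S_n}(-q)^{l(\sigma)}e_{\sigma(1)}\otimes\cdots\otimes e_{\sigma(n)}$; and to a source the map $V^{\otimes n}\to\mathbb Z[q^{\pm1/n}]$ with $e_{\sigma(1)}\otimes\cdots\otimes e_{\sigma(n)}\mapsto(-q)^{l(\sigma)}$ for $\sigma\in S_n$ and all other basis tensors $\mapsto 0$. Here $l(\sigma)$ is the number of inversions of $\sigma$. The bracket $\langle\Gamma\rangle_n\in\mathbb Z[q^{\pm 1/n}]$ is the contraction of these tensors. *States.* A state $S$ of a planar $n$-web $\Gamma$ is a labelling of its bands and annuli by elements of $\{1,\dots,n\}$ such that the $n$ bands at each vertex have different labels. Order the bands at a vertex starting from its marked point, clockwise at a sink and counterclockwise at a source; $P(S,v)\in S_n$ sends $i$ to the label of the $i$-th band at $v$. *Skein tree.* The bracket satisfies, for a positive crossing, $$\langle\text{crossing}\rangle_n=q^{\frac{n-1}{n}}\langle\text{oriented smoothing}\rangle_n-q^{-\frac{n(n-1)}{2}-\frac1n}\frac{1}{[n-2]!}\langle\text{singular web}\rangle_n,$$ and an analogous relation, with the same two diagrams, for a negative crossing. In the singular web the two incoming strands of the crossing end in a sink,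 the two outgoing strands start at a source, and $n-2$ parallel bands lead from the source to the sink; it is the partial closure, by the last $n-2$ strands on the right, of a sink placed above a source. The skein tree of a link diagram $L$ is obtained by repeatedly replacing a crossing by its smoothing or by its singular web; its leaves are the diagrams without crossings so obtained. **Proposition.** Let the planar $n$-web $\Gamma$ be a leaf of the skein tree of a link diagram $L$. Then $\sum_v l(P(S,v))$, the sum being over all vertices $v$ of $\Gamma$, is even for every state $S$ of $\Gamma$. Moreover $\langle\Gamma\rangle_n$ lies in $\mathbb Z[q^{\pm1}]$ and all its coefficients are non-negative. -/

import Mathlib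

/-!
# Web diagrams, states, the `SU_n` bracket and the skein tree

A web diagram is given, as usual for Reshetikhin-Turaev invariants, by a decomposition of a diagram
in the plane into elementary horizontal slices. Diagrams are read from the bottom to the top; each
slice contains one elementary piece (a crossing, a cup, a cap, an `n`-valent source or an
`n`-valent sink) and vertical strands to the left and to the right of it.
Labels are elements of `Fin n`; the label `i : Fin n` stands for the number `i + 1` of `{1, …, n}`.
-/

namespace Web

open scoped LaurentPolynomial

/-- The direction of a vertical strand. Downward strands carry the representation `V` with basis
`e_i`, upward strands carry the dual representation `V*` with basis `e^i`. -/
inductive Strand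
  | down
  | up
  deriving DecidableEq

/-- The elementary pieces of web diagrams.
* `crossPos`, `crossNeg`: a positive, a negative crossing of two downward strands.
* `cupPlus`, `cupMinus`: an arc with two upper end points, oriented counterclockwise, clockwise.
* `capPlus`, `capMinus`: an arc with two lower end points, oriented clockwise, counterclockwise.
* `source`: an `n`-valent source, whose `n` outgoing bands leave downwards and whose marked point is
  at its top.
* `sink`: an `n`-valent sink, whose `n` incoming bands arrive from above and whose marked point is
  at its bottom. -/
inductive Piece
  | crossPos
  | crossNeg
  | cupPlus
  | cupMinus
  | capPlus
  | capMinus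
  | source
  | sink
  deriving DecidableEq

/-- The strands at the bottom of a piece, from left to right. -/
def Piece.dom (n : ℕ) : Piece → List Strand
  | crossPos => [.down, .down]
  | crossNeg => [.down, .down]
  | cupPlus => []
  | cupMinus => []
  | capPlus => [.up, .down]
  | capMinus => [.down, .up]
  | source => List.replicate n .down
  | sink => []

/-- The strands at the top of a piece, from left to right. -/
def Piece.cod (n : ℕ) : Piece → List Strand
  | crossPos => [.down, .down]
  | crossNeg => [.down, .down]
  | cupPlus => [.down, .up]
  | cupMinus => [.up, .down]
  | capPlus => []
  | capMinus => []
  | source => []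
  | sink => List.replicate n .down

/-- The piece is a crossing. -/
def Piece.IsCrossing (p : Piece) : Prop := p = crossPos ∨ p = crossNeg

/-- The piece is a vertex (a source or a sink). -/
def Piece.IsVertex (p : Piece) : Prop := p = source ∨ p = sink

instance : DecidablePred Piece.IsVertex := fun p => by unfold Piece.IsVertex; infer_instance

instance : DecidablePred Piece.IsCrossing := fun p => by unfold Piece.IsCrossing; infer_instance

/-- A horizontal slice of a web diagram. -/
structure Slice where
  /-- the vertical strands to the left of the piece -/
  left : List Strand
  /-- the elementary piece of the slice -/
  piece : Piece
  /-- the vertical strands to the right of the piece -/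
  right : List Strand
  deriving DecidableEq

/-- The strands at the bottom of a slice. -/
def Slice.bottom (n : ℕ) (s : Slice) : List Strand := s.left ++ s.piece.dom n ++ s.right

/-- The strands at the top of a slice. -/
def Slice.top (n : ℕ) (s : Slice) : List Strand := s.left ++ s.piece.cod n ++ s.right

/-- The strands that meet the `k`-th horizontal line: for `k < D.length` the line below the `k`-th
slice; there are none above the last slice. -/
def level (n : ℕ) (D : List Slice) (k : ℕ) : List Strand :=
  match D[k]? with
  | some s => s.bottom n
  | none => []

/-- An `n`-web diagram: a list of slices, from bottom to top, which fit together and which have no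
strands below the first and above the last slice. -/
structure WebDiagram (n : ℕ) where
  slices : List Slice
  level_zero : level n slices 0 = []
  level_succ : ∀ (k : ℕ) (s : Slice), slices[k]? = some s → level n slices (k + 1) = s.top n

variable {n : ℕ}

namespace WebDiagram

/-- A link diagram: a web diagram without vertices. -/
def IsLink (D : WebDiagram n) : Prop := ∀ s ∈ D.slices, ¬ s.piece.IsVertex

/-- A planar diagram: a diagram without crossings. -/
def IsPlanar (D : WebDiagram n) : Prop := ∀ s ∈ D.slices, ¬ s.piece.IsCrossing

end WebDiagram

/-! ### Bands, annuli and states -/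

/-- The strand points of a diagram: `(k, p)` is the `p`-th point, from the left, on the `k`-th
horizontal line. -/
def Point (D : WebDiagram n) : Type :=
  {x : ℕ × ℕ // x.1 ≤ D.slices.length ∧ x.2 < (level n D.slices x.1).length}

/-- `Glued n D x y`: the strand points `x` and `y` are the two end points of one strand in some
slice of the diagram. -/
inductive Glued (n : ℕ) (D : List Slice) : ℕ × ℕ → ℕ × ℕ → Prop
  | left (k : ℕ) (s : Slice) (p : ℕ) : D[k]? = some s → p < s.left.length →
      Glued n D (k, p) (k + 1, p)
  | right (k : ℕ) (s : Slice) (p : ℕ) : D[k]? = some s → p < s.right.length →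
      Glued n D (k, s.left.length + (s.piece.dom n).length + p)
        (k + 1, s.left.length + (s.piece.cod n).length + p)
  | cross₁ (k : ℕ) (s : Slice) : D[k]? = some s → s.piece.IsCrossing →
      Glued n D (k, s.left.length) (k + 1, s.left.length + 1)
  | cross₂ (k : ℕ) (s : Slice) : D[k]? = some s → s.piece.IsCrossing →
      Glued n D (k, s.left.length + 1) (k + 1, s.left.length)
  | cup (k : ℕ) (s : Slice) : D[k]? = some s → s.piece = .cupPlus ∨ s.piece = .cupMinus →
      Glued n D (k + 1, s.left.length) (k + 1, s.left.length + 1)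
  | cap (k : ℕ) (s : Slice) : D[k]? = some s → s.piece = .capPlus ∨ s.piece = .capMinus →
      Glued n D (k, s.left.length) (k, s.left.length + 1)

/-- The bands and annuli of a diagram: the classes of strand points under the equivalence relation
generated by gluing. -/
def Edge (D : WebDiagram n) : Type := Quot fun x y : Point D => Glued n D.slices x.1 y.1

/-- The vertices (sources and sinks) of a diagram. -/
abbrev Vertex (D : WebDiagram n) : Type := {k : Fin D.slices.length // D.slices[k].piece.IsVertex}

/-- The end point at the vertex `v` of the `i`-th band attached to `v`. The canonical order of the
bands (clockwise from the marked point at a sink, counterclockwise from the marked point at a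
source) is in both cases the order from left to right. -/
def leg (D : WebDiagram n) (v : Vertex D) (i : Fin n) : ℕ × ℕ :=
  (if D.slices[v.1].piece = .source then (v.1 : ℕ) else v.1 + 1,
    D.slices[v.1].left.length + i)

lemma leg_mem (D : WebDiagram n) (v : Vertex D) (i : Fin n) :
    (leg D v i).1 ≤ D.slices.length ∧
      (leg D v i).2 < (level n D.slices (leg D v i).1).length := by
  obtain ⟨⟨k, hk⟩, hv⟩ := v
  have hs : D.slices[k]? = some D.slices[k] := List.getElem?_eq_getElem hk
  have h1 := D.level_succ k _ hs
  have hi := i.2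
  rcases hv with h | h
  all_goals
    simp only [Fin.getElem_fin] at h
    simp [leg, h, h1]
  · simp [level, hs, Slice.bottom, h, Piece.dom]
    omega
  · simp [Slice.top, h, Piece.cod]
    omega

/-- The `i`-th band attached to the vertex `v`. -/
def legEdge (D : WebDiagram n) (v : Vertex D) (i : Fin n) : Edge D :=
  Quot.mk _ ⟨leg D v i, leg_mem D v i⟩

/-- A state: a labelling of the bands and annuli such that the bands attached to each vertex are
labelled by different numbers. -/
structure State (D : WebDiagram n) where
  label : Edge D → Fin n
  distinct : ∀ v : Vertex D, Function.Injective fun i => label (legEdge D v i)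

/-- The permutation `P(S, v)`: it sends `i` to the label of the `i`-th band attached to `v`. -/
noncomputable def State.perm {D : WebDiagram n} (S : State D) (v : Vertex D) :
    Equiv.Perm (Fin n) :=
  Equiv.ofBijective (fun i => S.label (legEdge D v i))
    (Finite.injective_iff_bijective.1 (S.distinct v))

/-- The length of a permutation: its number of inversions. -/
def permLength (σ : Equiv.Perm (Fin n)) : ℕ :=
  (Finset.univ.filter fun x : Fin n × Fin n => x.1 < x.2 ∧ σ x.2 < σ x.1).card

/-! ### The bracket -/

/-- The ring `ℤ[q^{± 1/n}]`, as the ring of Laurent polynomials in the variable `q^{1/n}`. -/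
abbrev Coeff : Type := ℤ[T;T⁻¹]

/-- The element `q` of `ℤ[q^{± 1/n}]`. -/
noncomputable def q (n : ℕ) : Coeff := LaurentPolynomial.T (n : ℤ)

/-- The power `q ^ k`, for an integer `k`, in `ℤ[q^{± 1/n}]`. -/
noncomputable def qPow (n : ℕ) (k : ℤ) : Coeff := LaurentPolynomial.T ((n : ℤ) * k)

/-- The free module on words of labels. The span of the words of length `k` is the tensor product
of `k` factors `V` or `V*`, with its basis of tensors of the vectors `e_i` or `e^i`. -/
abbrev Tensors (n : ℕ) : Type := List (Fin n) →₀ Coeff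

/-- The tensor of an elementary piece: the image of the basis vector given by a word of labels at
the bottom of the piece. The factor `T (-1)` is `q^{-1/n}` and `T 1` is `q^{1/n}`; the tensor of
`crossPos` is the matrix `R̂`, that of `crossNeg` is its inverse. -/
noncomputable def Piece.tensor (n : ℕ) : Piece → List (Fin n) → Tensors n
  | crossPos, [i, j] =>
      (LaurentPolynomial.T (-1) : Coeff) •
        (if j < i then Finsupp.single [j, i] 1
        else if i = j then Finsupp.single [i, j] (q n)
        else Finsupp.single [j, i] 1 + Finsupp.single [i, j] (q n - qPow n (-1)))
  | crossNeg, [i, j] =>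
      (LaurentPolynomial.T 1 : Coeff) •
        (if i < j then Finsupp.single [j, i] 1
        else if i = j then Finsupp.single [i, j] (qPow n (-1))
        else Finsupp.single [j, i] 1 - Finsupp.single [i, j] (q n - qPow n (-1)))
  | cupPlus, [] => ∑ i : Fin n, Finsupp.single [i, i] 1
  | cupMinus, [] =>
      ∑ i : Fin n, Finsupp.single [i, i] (qPow n ((n : ℤ) + 1 - 2 * ((i : ℤ) + 1)))
  | capPlus, [i, j] => if i = j then Finsupp.single [] 1 else 0
  | capMinus, [i, j] =>
      if i = j then Finsupp.single [] (qPow n (2 * ((i : ℤ) + 1) - (n : ℤ) - 1)) else 0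
  | source, w =>
      ∑ σ : Equiv.Perm (Fin n),
        if w = List.ofFn σ then Finsupp.single [] ((-q n) ^ permLength σ) else 0
  | sink, [] =>
      ∑ σ : Equiv.Perm (Fin n), Finsupp.single (List.ofFn σ) ((-q n) ^ permLength σ)
  | _, _ => 0

/-- The linear map of a slice: the tensor of its piece, tensored with the identities of the strands
to the left and to the right of the piece. -/
noncomputable def Slice.act (n : ℕ) (s : Slice) : Tensors n →ₗ[Coeff] Tensors n :=
  Finsupp.linearCombination Coeff fun w =>
    (s.piece.tensor n ((w.drop s.left.length).take (s.piece.dom n).length)).mapDomain fun u =>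
      w.take s.left.length ++ u ++ w.drop (s.left.length + (s.piece.dom n).length)

/-- The bracket of a web diagram: the scalar obtained by contracting the tensors of all its
pieces, that is, the composition of the maps of its slices. -/
noncomputable def bracket (D : WebDiagram n) : Coeff :=
  (D.slices.foldl (fun x s => s.act n x) (Finsupp.single [] 1)) []

/-- The inclusion of `ℤ[q^{± 1}]` (Laurent polynomials in the variable `q`) into `ℤ[q^{± 1/n}]`. -/
noncomputable def inclusion (n : ℕ) : ℤ[T;T⁻¹] →+* Coeff :=
  AddMonoidAlgebra.mapDomainRingHom ℤ (AddMonoidHom.mulLeft (n : ℤ))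

/-! ### The skein tree -/

/-- The web that replaces a crossing of two downward strands, with the vertical strands `l` to its
left and `r` to its right, in the second term of the skein relation: the two strands coming from
above run into a sink, the two strands going down leave a source below that sink, and the `n - 2`
other bands of the source run in parallel, to the right of the two vertices, to the sink. The slices
are listed from bottom to top. -/
def singular (n : ℕ) (l r : List Strand) : List Slice :=
  (List.range (n - 2)).map (fun j =>
      ⟨l ++ List.replicate (2 + j) .down, .cupPlus, List.replicate j .up ++ r⟩) ++
  [⟨l, .source, List.replicate (n - 2) .up ++ r⟩, ⟨l, .sink, List.replicate (n - 2) .up ++ r⟩] ++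
  (List.range (n - 2)).reverse.map (fun j =>
      ⟨l ++ List.replicate (2 + j) .down, .capMinus, List.replicate j .up ++ r⟩)

/-- `E` is one of the two children of the node `D` of a skein tree: one crossing of `D` is replaced
either by its oriented smoothing (two vertical strands) or by the web `singular`. -/
def SkeinStep (D E : WebDiagram n) : Prop :=
  ∃ (X Y : List Slice) (s : Slice), s.piece.IsCrossing ∧ D.slices = X ++ s :: Y ∧
    (E.slices = X ++ Y ∨ E.slices = X ++ singular n s.left s.right ++ Y)

/-- `Γ` is a leaf of the skein tree of `D`: it arises from `D` by skein steps and has no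
crossings. -/
def IsLeaf (D Γ : WebDiagram n) : Prop :=
  Relation.ReflTransGen SkeinStep D Γ ∧ Γ.IsPlanar

end Web

namespace Web

open scoped LaurentPolynomial

variable {n : ℕ}

/-! ### Inversions of words -/

/-! Sweep a horizontal line upwards through the planar web and follow the parity of the number of
inversions of the word of labels on it, upward and downward strands being treated alike. A cup or
cap inserts or deletes two adjacent equal letters and preserves the parity
(`inversions_insert_pair`). A single vertex may change it uncontrollably, but in a leaf of the skein
tree each source lies directly below a sink at the same place (`IsLeaf.sourceSinkPaired`). Such a
pair replaces a block `σ` by a block `τ`, which changes the parity by `l(σ) + l(τ)`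
(`inversions_replace_ofFn`). The lowest and highest words are empty, so these changes telescope to
an even total (`State.sum_vertexLength_suffix`).

The bracket obeys the same law: the coefficient of a word `w` keeps the sign `(-1) ^ inversions w`,
up to non-negative combinations of integral powers of `q` (`foldl_act_mem_signedCone`). At the empty
word the sign is `+1`. -/

/-- The number of inversions of a word of labels. -/
def inversions : List (Fin n) → ℕ
  | [] => 0
  | a :: w => w.countP (· < a) + inversions w

lemma inversions_append (A B : List (Fin n)) :
    inversions (A ++ B) =
      inversions A + inversions B + (A.map fun a => B.countP (· < a)).sum := by
  induction A with
  | nil => simp [inversions]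
  | cons a A ih => simp [inversions, ih]; omega

/-- The two equal letters form no inversion with each other, and every other letter is inverted with
both or with neither. -/
lemma inversions_insert_pair (A B : List (Fin n)) (i : Fin n) :
    inversions (A ++ [i, i] ++ B) % 2 = inversions (A ++ B) % 2 := by
  induction A with
  | nil => simp [inversions]; omega
  | cons a A ih =>
    simp only [List.append_assoc, List.cons_append, List.nil_append, inversions,
      List.countP_append, List.countP_cons] at ih ⊢
    omega

/-- Inversions between a block and its surroundings depend only on the multiset of letters of the
block. The additive form avoids subtraction in `ℕ`. -/
lemma inversions_replace_perm {M M' : List (Fin n)} (h : M.Perm M') (A B : List (Fin n)) :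
    inversions (A ++ M ++ B) + inversions M' = inversions (A ++ M' ++ B) + inversions M := by
  have h1 : ∀ a : Fin n, M.countP (· < a) = M'.countP (· < a) := fun a => h.countP_eq _
  have h2 := (h.map fun a => B.countP (· < a)).sum_eq
  simp only [inversions_append, List.map_append, List.sum_append, h1, h2]
  omega

lemma countP_ofFn {α : Type*} {m : ℕ} (p : α → Bool) (f : Fin m → α) :
    (List.ofFn f).countP p = ∑ i, if p (f i) then 1 else 0 := by
  induction m with
  | zero => simp
  | succ m ih => rw [List.ofFn_succ, List.countP_cons, ih, Fin.sum_univ_succ, add_comm]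

lemma inversions_ofFn {m : ℕ} (f : Fin m → Fin n) :
    inversions (List.ofFn f) =
      (Finset.univ.filter fun x : Fin m × Fin m => x.1 < x.2 ∧ f x.2 < f x.1).card := by
  induction m with
  | zero => simp [inversions]
  | succ m ih =>
    rw [List.ofFn_succ, inversions, ih, countP_ofFn, Finset.card_filter, Finset.card_filter,
      Fintype.sum_prod_type, Fintype.sum_prod_type, Fin.sum_univ_succ]
    simp [Fin.sum_univ_succ, Fin.succ_pos, -Finset.sum_boole]

lemma inversions_ofFn_perm (σ : Equiv.Perm (Fin n)) :
    inversions (List.ofFn σ) = permLength σ := inversions_ofFn _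

lemma ofFn_perm_ofFn (σ τ : Equiv.Perm (Fin n)) : (List.ofFn σ).Perm (List.ofFn τ) := by
  have h := Equiv.Perm.ofFn_comp_perm (τ⁻¹ * σ) τ
  have : (⇑τ ∘ ⇑(τ⁻¹ * σ)) = σ := by ext i; simp
  rwa [this] at h

lemma inversions_replace_ofFn (σ τ : Equiv.Perm (Fin n)) (A B : List (Fin n)) :
    (inversions (A ++ List.ofFn σ ++ B) + permLength σ) % 2 =
      (inversions (A ++ List.ofFn τ ++ B) + permLength τ) % 2 := by
  have h := inversions_replace_perm (ofFn_perm_ofFn σ τ) A B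
  rw [inversions_ofFn_perm, inversions_ofFn_perm] at h
  omega

/-! ### Source-sink pairs in the skein tree -/

/-- Every source is immediately followed by a sink with the same strands to its left and right,
and there are no other vertices. -/
inductive SourceSinkPaired : List Slice → Prop
  | nil : SourceSinkPaired []
  | cons (s : Slice) (D : List Slice) : ¬ s.piece.IsVertex → SourceSinkPaired D →
      SourceSinkPaired (s :: D)
  | pair (l r : List Strand) (D : List Slice) : SourceSinkPaired D →
      SourceSinkPaired (⟨l, .source, r⟩ :: ⟨l, .sink, r⟩ :: D)

namespace SourceSinkPaired

lemma of_forall {D : List Slice} (h : ∀ s ∈ D, ¬ s.piece.IsVertex) : SourceSinkPaired D := by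
  induction D with
  | nil => exact .nil
  | cons s D ih => exact .cons s D (h s (by simp)) (ih fun t ht => h t (by simp [ht]))

lemma append {X Y : List Slice} (hX : SourceSinkPaired X) (hY : SourceSinkPaired Y) :
    SourceSinkPaired (X ++ Y) := by
  induction hX with
  | nil => exact hY
  | cons s D hs _ ih => exact .cons s _ hs ih
  | pair l r D _ ih => exact .pair l r _ ih

/-- A slice that is not a vertex cannot be half of a pair, so cutting there breaks no pair. -/
lemma split {X Y : List Slice} {s : Slice} (hs : ¬ s.piece.IsVertex)
    (h : SourceSinkPaired (X ++ s :: Y)) : SourceSinkPaired X ∧ SourceSinkPaired Y := by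
  generalize hD : X ++ s :: Y = D at h
  induction h generalizing X with
  | nil => simp at hD
  | cons t D ht hD' ih =>
    cases X with
    | nil =>
      obtain ⟨rfl, rfl⟩ := List.cons.inj hD
      exact ⟨.nil, hD'⟩
    | cons x X =>
      obtain ⟨rfl, h⟩ := List.cons.inj hD
      exact ⟨.cons _ _ ht (ih h).1, (ih h).2⟩
  | pair l r D _ ih =>
    match X with
    | [] =>
      obtain ⟨rfl, -⟩ := List.cons.inj hD
      exact absurd (Or.inl rfl) hs
    | [x] =>
      simp only [List.cons_append, List.nil_append, List.cons.injEq] at hD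
      obtain ⟨-, rfl, -⟩ := hD
      exact absurd (Or.inr rfl) hs
    | x :: y :: X =>
      simp only [List.cons_append, List.cons.injEq] at hD
      obtain ⟨rfl, rfl, h⟩ := hD
      exact ⟨.pair _ _ _ (ih h).1, (ih h).2⟩

end SourceSinkPaired

lemma sourceSinkPaired_singular (n : ℕ) (l r : List Strand) :
    SourceSinkPaired (singular n l r) := by
  unfold singular
  refine ((SourceSinkPaired.of_forall ?_).append (.pair _ _ _ .nil)).append
    (SourceSinkPaired.of_forall ?_)
  all_goals
    intro s hs
    obtain ⟨j, -, rfl⟩ := List.mem_map.1 hs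
    simp [Piece.IsVertex]

lemma SkeinStep.sourceSinkPaired {D E : WebDiagram n} (h : SkeinStep D E)
    (hD : SourceSinkPaired D.slices) : SourceSinkPaired E.slices := by
  obtain ⟨X, Y, s, hs, hDs, hE⟩ := h
  have hv : ¬ s.piece.IsVertex := by
    rcases hs with hs | hs <;> simp [Piece.IsVertex, hs]
  obtain ⟨hX, hY⟩ := SourceSinkPaired.split hv (hDs ▸ hD)
  rcases hE with hE | hE
  · exact hE ▸ hX.append hY
  · exact hE ▸ (hX.append (sourceSinkPaired_singular n _ _)).append hY

lemma IsLeaf.sourceSinkPaired {L Γ : WebDiagram n} (hL : L.IsLink) (h : IsLeaf L Γ) :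
    SourceSinkPaired Γ.slices := by
  obtain ⟨h, -⟩ := h
  induction h with
  | refl => exact .of_forall hL
  | tail _ hs ih => exact hs.sourceSinkPaired ih

/-! ### The bracket -/

/-- The Laurent polynomials in `q` with non-negative coefficients. -/
noncomputable def posCone (n : ℕ) : AddSubmonoid Coeff :=
  AddSubmonoid.closure (Set.range (qPow n))

/-- The tensors whose coordinate at every word `w` is `(-1) ^ inversions w` times a Laurent
polynomial in `q` with non-negative coefficients. -/
noncomputable def signedCone (n : ℕ) : AddSubmonoid (Tensors n) :=
  AddSubmonoid.closure
    {x | ∃ (w : List (Fin n)) (k : ℤ), x = Finsupp.single w ((-1) ^ inversions w * qPow n k)}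

lemma inclusion_T (n : ℕ) (k : ℤ) : inclusion n (LaurentPolynomial.T k) = qPow n k :=
  AddMonoidAlgebra.mapDomain_single

/-- The generators are integral powers of `q`, so integrality of the exponents and positivity come
out together. -/
lemma exists_inclusion_of_mem_posCone {x : Coeff} (hx : x ∈ posCone n) :
    ∃ f : ℤ[T;T⁻¹], x = inclusion n f ∧ ∀ k : ℤ, 0 ≤ f.coeff k := by
  induction hx using AddSubmonoid.closure_induction with
  | mem x hx =>
    obtain ⟨k, rfl⟩ := hx
    refine ⟨LaurentPolynomial.T k, (inclusion_T n k).symm, fun j => ?_⟩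
    rw [LaurentPolynomial.T, AddMonoidAlgebra.coeff_single, Finsupp.single_apply]
    split_ifs <;> simp
  | zero => exact ⟨0, by simp, fun k => by simp⟩
  | add x y _ _ hx hy =>
    obtain ⟨f, rfl, hf⟩ := hx
    obtain ⟨g, rfl, hg⟩ := hy
    exact ⟨f + g, by simp, fun k => by simpa using add_nonneg (hf k) (hg k)⟩

lemma apply_nil_mem_posCone {x : Tensors n} (hx : x ∈ signedCone n) : x [] ∈ posCone n := by
  induction hx using AddSubmonoid.closure_induction with
  | mem x hx =>
    obtain ⟨w, k, rfl⟩ := hx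
    rw [Finsupp.single_apply]
    split_ifs with hw
    · subst hw
      simpa [inversions, posCone] using AddSubmonoid.subset_closure (Set.mem_range_self k)
    · exact zero_mem _
  | zero => simp
  | add x y _ _ hx hy => simpa using add_mem hx hy

lemma single_mem_signedCone {w : List (Fin n)} {a : ℕ} (h : a % 2 = inversions w % 2) (k : ℤ) :
    Finsupp.single w ((-1) ^ a * qPow n k) ∈ signedCone n := by
  refine AddSubmonoid.subset_closure ⟨w, k, ?_⟩
  have e : Even a ↔ Even (inversions w) := by rw [Nat.even_iff, Nat.even_iff, h]
  rw [neg_one_pow_congr e]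

lemma map_mem_signedCone {F : Tensors n →ₗ[Coeff] Tensors n}
    (hF : ∀ (w : List (Fin n)) (k : ℤ),
      F (Finsupp.single w ((-1) ^ inversions w * qPow n k)) ∈ signedCone n)
    {x : Tensors n} (hx : x ∈ signedCone n) : F x ∈ signedCone n := by
  induction hx using AddSubmonoid.closure_induction with
  | mem x hx =>
    obtain ⟨w, k, rfl⟩ := hx
    exact hF w k
  | zero => simp
  | add x y _ _ hx hy => simpa using add_mem hx hy

/-! ### Slices acting on the signed cone -/

lemma qPow_mul (n : ℕ) (a b : ℤ) : qPow n a * qPow n b = qPow n (a + b) := by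
  rw [qPow, qPow, qPow, ← LaurentPolynomial.T_add, mul_add]

lemma neg_q_pow (n l : ℕ) : (-q n) ^ l = (-1) ^ l * qPow n l := by
  rw [neg_pow, q, qPow, LaurentPolynomial.T_pow, mul_comm (n : ℤ)]

lemma Slice.act_single (s : Slice) (w : List (Fin n)) (c : Coeff) :
    s.act n (Finsupp.single w c) =
      c • (s.piece.tensor n ((w.drop s.left.length).take (s.piece.dom n).length)).mapDomain
        fun u => w.take s.left.length ++ u ++ w.drop (s.left.length + (s.piece.dom n).length) := by
  rw [Slice.act, Finsupp.linearCombination_single]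

lemma eq_take_append_append_drop {α : Type*} (w : List α) (a b : ℕ) :
    w = w.take a ++ (w.drop a).take b ++ w.drop (a + b) := by
  rw [List.append_assoc, ← List.drop_drop, List.take_append_drop, List.take_append_drop]

lemma cup_mem_signedCone (w : List (Fin n)) (p : ℕ) (k j : ℤ) (i : Fin n) :
    Finsupp.single (w.take p ++ [i, i] ++ w.drop p)
      ((-1) ^ inversions w * qPow n k * qPow n j) ∈ signedCone n := by
  rw [mul_assoc, qPow_mul]
  refine single_mem_signedCone ?_ _
  rw [inversions_insert_pair, List.take_append_drop]

/-- This is the insertion of a pair read backwards: `w` is the resulting word with `[i, i]` inserted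
at `p`. -/
lemma cap_mem_signedCone (w : List (Fin n)) (p : ℕ) (k j : ℤ) (i : Fin n)
    (h : (w.drop p).take 2 = [i, i]) :
    Finsupp.single (w.take p ++ w.drop (p + 2))
      ((-1) ^ inversions w * qPow n k * qPow n j) ∈ signedCone n := by
  rw [mul_assoc, qPow_mul]
  refine single_mem_signedCone ?_ _
  rw [← inversions_insert_pair _ _ i, ← h, ← eq_take_append_append_drop]

lemma qPow_zero (n : ℕ) : qPow n 0 = 1 := by simp [qPow]

/-- Every nonzero entry of a cup or cap is a power of `q` with sign `+1`, and the parity of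
inversions is unchanged. -/
lemma Slice.act_mem_signedCone {s : Slice} (hv : ¬ s.piece.IsVertex) (hc : ¬ s.piece.IsCrossing)
    {x : Tensors n} (hx : x ∈ signedCone n) : s.act n x ∈ signedCone n := by
  refine map_mem_signedCone (fun w k => ?_) hx
  rw [Slice.act_single]
  obtain ⟨l, p, r⟩ := s
  cases p with
  | crossPos => exact absurd (Or.inl rfl) hc
  | crossNeg => exact absurd (Or.inr rfl) hc
  | source => exact absurd (Or.inl rfl) hv
  | sink => exact absurd (Or.inr rfl) hv
  | cupPlus =>
    simp only [Piece.dom, List.length_nil, List.take_zero, Piece.tensor, add_zero,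
      Finsupp.mapDomain_finsetSum, Finsupp.mapDomain_single, Finset.smul_sum, Finsupp.smul_single,
      smul_eq_mul]
    exact sum_mem fun i _ => qPow_zero n ▸ cup_mem_signedCone w _ k 0 i
  | cupMinus =>
    simp only [Piece.dom, List.length_nil, List.take_zero, Piece.tensor, add_zero,
      Finsupp.mapDomain_finsetSum, Finsupp.mapDomain_single, Finset.smul_sum, Finsupp.smul_single,
      smul_eq_mul]
    exact sum_mem fun i _ => cup_mem_signedCone w _ k _ i
  | capPlus =>
    simp only [Piece.dom, List.length_cons, List.length_nil, zero_add, Nat.reduceAdd]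
    have h := cap_mem_signedCone w l.length k 0
    rcases hu : (w.drop l.length).take 2 with _ | ⟨i, _ | ⟨j, _ | ⟨a, u⟩⟩⟩
    -- Blocks whose length is not two fall under the default clause of `Piece.tensor` and give `0`.
    any_goals simp [Piece.tensor]
    by_cases hij : i = j
    · subst hij
      simpa [Finsupp.mapDomain_single, qPow_zero] using h i hu
    · simp [hij]
  | capMinus =>
    simp only [Piece.dom, List.length_cons, List.length_nil, zero_add, Nat.reduceAdd]
    have h := cap_mem_signedCone w l.length k
    rcases hu : (w.drop l.length).take 2 with _ | ⟨i, _ | ⟨j, _ | ⟨a, u⟩⟩⟩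
    any_goals simp [Piece.tensor]
    by_cases hij : i = j
    · subst hij
      simpa [Finsupp.mapDomain_single] using h _ i hu
    · simp [hij]

lemma act_source_single (l r : List Strand) (w : List (Fin n)) (c : Coeff) :
    Slice.act n ⟨l, .source, r⟩ (Finsupp.single w c) =
      ∑ σ : Equiv.Perm (Fin n), if (w.drop l.length).take n = List.ofFn σ then
        Finsupp.single (w.take l.length ++ w.drop (l.length + n)) (c * (-q n) ^ permLength σ)
      else 0 := by
  rw [Slice.act_single]
  simp only [Piece.dom, List.length_replicate, Piece.tensor, Finsupp.mapDomain_finsetSum,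
    Finset.smul_sum]
  refine Finset.sum_congr rfl fun σ _ => ?_
  split_ifs <;> simp [Finsupp.mapDomain_single]

lemma act_sink_single (l r : List Strand) (w : List (Fin n)) (c : Coeff) :
    Slice.act n ⟨l, .sink, r⟩ (Finsupp.single w c) =
      ∑ τ : Equiv.Perm (Fin n), Finsupp.single (w.take l.length ++ List.ofFn τ ++ w.drop l.length)
        (c * (-q n) ^ permLength τ) := by
  rw [Slice.act_single]
  simp [Piece.dom, Piece.tensor, Finsupp.mapDomain_finsetSum, Finset.smul_sum,
    Finsupp.mapDomain_single]

/-- The signs `(-1) ^ l(σ)` of the source and `(-1) ^ l(τ)` of the sink together make up exactly the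
change of inversion parity from `σ` to `τ`. Neither factor alone need preserve the cone. -/
lemma act_sink_act_source_mem_signedCone (hn : 0 < n) (l r : List Strand) {x : Tensors n}
    (hx : x ∈ signedCone n) :
    Slice.act n ⟨l, .sink, r⟩ (Slice.act n ⟨l, .source, r⟩ x) ∈ signedCone n := by
  refine map_mem_signedCone (F := Slice.act n ⟨l, .sink, r⟩ ∘ₗ Slice.act n ⟨l, .source, r⟩)
    (fun w k => ?_) hx
  rw [LinearMap.comp_apply, act_source_single, map_sum]
  refine sum_mem fun σ _ => ?_
  split_ifs with h
  swap
  · simp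
  rw [act_sink_single]
  refine sum_mem fun τ _ => ?_
  have hw := eq_take_append_append_drop w l.length n
  rw [h] at hw
  -- As `n > 0`, the block found after position `l.length` is nonempty, so `w` is long enough to
  -- fill the left part. Hence the sink inserts its block exactly where the source removed one.
  have hl : (w.take l.length).length = l.length := by
    have := congrArg List.length h
    simp at this ⊢
    omega
  rw [List.take_append_of_le_length hl.ge, List.take_of_length_le hl.le,
    List.drop_append_of_le_length hl.ge, List.drop_of_length_le hl.le, List.nil_append,
    neg_q_pow, neg_q_pow]
  have hp := inversions_replace_ofFn σ τ (w.take l.length) (w.drop (l.length + n))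
  rw [← hw] at hp
  convert single_mem_signedCone (n := n) (a := inversions w + permLength σ + permLength τ)
    (w := w.take l.length ++ List.ofFn τ ++ w.drop (l.length + n)) (by omega)
    (k + permLength σ + permLength τ) using 2
  rw [← qPow_mul, ← qPow_mul]
  ring

lemma foldl_act_mem_signedCone (hn : 0 < n) {D : List Slice} (h : SourceSinkPaired D)
    (hD : ∀ s ∈ D, ¬ s.piece.IsCrossing) {x : Tensors n} (hx : x ∈ signedCone n) :
    D.foldl (fun x s => s.act n x) x ∈ signedCone n := by
  induction h generalizing x with
  | nil => exact hx
  | cons s D hs _ ih =>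
    exact ih (fun t ht => hD t (by simp [ht])) (s.act_mem_signedCone hs (hD s (by simp)) hx)
  | pair l r D _ ih =>
    exact ih (fun t ht => hD t (by simp [ht])) (act_sink_act_source_mem_signedCone hn l r hx)

lemma bracket_mem_posCone (hn : 0 < n) {D : WebDiagram n}
    (h : SourceSinkPaired D.slices) (hD : D.IsPlanar) :
    bracket D ∈ posCone n := by
  refine apply_nil_mem_posCone (foldl_act_mem_signedCone hn h hD ?_)
  simpa [qPow_zero, inversions] using single_mem_signedCone (n := n) (w := []) (a := 0) rfl 0

/-! ### States -/

namespace State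

variable {D : WebDiagram n} (S : State D) (a : Fin n)

/-- The label of a strand point; the value is `a` outside the diagram. -/
def labelAt (x : ℕ × ℕ) : Fin n :=
  if h : x.1 ≤ D.slices.length ∧ x.2 < (level n D.slices x.1).length then
    S.label (Quot.mk _ ⟨x, h⟩)
  else a

/-- The labels of `m` consecutive points, from the `p`-th one on, of the `k`-th line. -/
def segment (k p m : ℕ) : List (Fin n) :=
  (List.range m).map fun j => S.labelAt a (k, p + j)

/-- The labels of the points of the `k`-th line. -/
def word (k : ℕ) : List (Fin n) :=
  S.segment a k 0 (level n D.slices k).length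

variable {S a}

lemma labelAt_eq_of_glued {x y : ℕ × ℕ} (h : Glued n D.slices x y)
    (hx : x.1 ≤ D.slices.length ∧ x.2 < (level n D.slices x.1).length)
    (hy : y.1 ≤ D.slices.length ∧ y.2 < (level n D.slices y.1).length) :
    S.labelAt a x = S.labelAt a y := by
  rw [labelAt, labelAt, dif_pos hx, dif_pos hy]
  exact congrArg S.label (Quot.sound h)

lemma segment_add (k p m m' : ℕ) :
    S.segment a k p (m + m') = S.segment a k p m ++ S.segment a k (p + m) m' := by
  simp [segment, List.range_add, add_assoc, Function.comp_def]

lemma segment_eq_segment {k k' p p' m : ℕ}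
    (h : ∀ j < m, S.labelAt a (k, p + j) = S.labelAt a (k', p' + j)) :
    S.segment a k p m = S.segment a k' p' m :=
  List.map_congr_left fun j hj => h j (List.mem_range.1 hj)

variable {k : ℕ} {s : Slice}

lemma level_of_getElem? (hs : D.slices[k]? = some s) : level n D.slices k = s.bottom n := by
  simp [level, hs]

lemma word_eq (hs : D.slices[k]? = some s) :
    S.word a k = S.segment a k 0 s.left.length ++
      S.segment a k s.left.length (s.piece.dom n).length ++
      S.segment a k (s.left.length + (s.piece.dom n).length) s.right.length := by
  rw [word, level_of_getElem? hs, Slice.bottom, List.length_append, List.length_append,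
    segment_add, segment_add, zero_add, zero_add]

/-- Vertical strands carry their labels upwards, so the outer segments can be taken from the lower
line `k`. Compared with `word_eq`, only the middle block differs. -/
lemma word_succ_eq (hs : D.slices[k]? = some s) :
    S.word a (k + 1) = S.segment a k 0 s.left.length ++
      S.segment a (k + 1) s.left.length (s.piece.cod n).length ++
      S.segment a k (s.left.length + (s.piece.dom n).length) s.right.length := by
  have hk : k < D.slices.length := (List.getElem?_eq_some_iff.1 hs).1
  have h0 := level_of_getElem? hs
  have h1 := D.level_succ k s hs
  rw [word, h1, Slice.top, List.length_append, List.length_append,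
    segment_add, segment_add, zero_add, zero_add]
  congr 1
  · congr 1
    refine (segment_eq_segment fun j hj => ?_).symm
    refine labelAt_eq_of_glued (by simpa using Glued.left k s j hs hj) ⟨hk.le, ?_⟩ ⟨hk, ?_⟩
    · simp [h0, Slice.bottom]; omega
    · simp [h1, Slice.top]; omega
  · refine (segment_eq_segment fun j hj => ?_).symm
    refine labelAt_eq_of_glued (Glued.right k s j hs hj) ⟨hk.le, ?_⟩ ⟨hk, ?_⟩
    · simp [h0, Slice.bottom]; omega
    · simp [h1, Slice.top]; omega

lemma segment_two (k p : ℕ) :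
    S.segment a k p 2 = [S.labelAt a (k, p), S.labelAt a (k, p + 1)] := rfl

lemma inversions_word_succ (hs : D.slices[k]? = some s) (hv : ¬ s.piece.IsVertex)
    (hc : ¬ s.piece.IsCrossing) :
    inversions (S.word a (k + 1)) % 2 = inversions (S.word a k) % 2 := by
  have hk : k < D.slices.length := (List.getElem?_eq_some_iff.1 hs).1
  have h0 := level_of_getElem? hs
  have h1 := D.level_succ k s hs
  have cup (h : s.piece = .cupPlus ∨ s.piece = .cupMinus)
      (hd : (s.piece.dom n).length = 0) (hd' : (s.piece.cod n).length = 2) :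
      inversions (S.word a (k + 1)) % 2 = inversions (S.word a k) % 2 := by
    have e : S.labelAt a (k + 1, s.left.length) = S.labelAt a (k + 1, s.left.length + 1) := by
      refine labelAt_eq_of_glued (Glued.cup k s hs h) ⟨hk, ?_⟩ ⟨hk, ?_⟩ <;>
        · simp [h1, Slice.top]; omega
    rw [word_succ_eq hs, word_eq hs, hd, hd', segment_two, e, inversions_insert_pair]
    simp [segment]
  have cap (h : s.piece = .capPlus ∨ s.piece = .capMinus)
      (hd : (s.piece.dom n).length = 2) (hd' : (s.piece.cod n).length = 0) :
      inversions (S.word a (k + 1)) % 2 = inversions (S.word a k) % 2 := by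
    have e : S.labelAt a (k, s.left.length) = S.labelAt a (k, s.left.length + 1) := by
      refine labelAt_eq_of_glued (Glued.cap k s hs h) ⟨hk.le, ?_⟩ ⟨hk.le, ?_⟩ <;>
        · simp [h0, Slice.bottom]; omega
    rw [word_succ_eq hs, word_eq hs, hd, hd', segment_two, e, inversions_insert_pair]
    simp [segment]
  rcases hp : s.piece
  · exact absurd (Or.inl hp) hc
  · exact absurd (Or.inr hp) hc
  · exact cup (Or.inl hp) (by simp [hp, Piece.dom]) (by simp [hp, Piece.cod])
  · exact cup (Or.inr hp) (by simp [hp, Piece.dom]) (by simp [hp, Piece.cod])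
  · exact cap (Or.inl hp) (by simp [hp, Piece.dom]) (by simp [hp, Piece.cod])
  · exact cap (Or.inr hp) (by simp [hp, Piece.dom]) (by simp [hp, Piece.cod])
  · exact absurd (Or.inl hp) hv
  · exact absurd (Or.inr hp) hv

/-! ### Parity of the vertex contributions -/

variable (S) in
/-- The length of `P(S, v)` if the `k`-th slice is a vertex `v`, and `0` otherwise. -/
noncomputable def vertexLength (k : ℕ) : ℕ :=
  if h : ∃ hk : k < D.slices.length, D.slices[k].piece.IsVertex then
    permLength (S.perm ⟨⟨k, h.1⟩, h.2⟩)
  else 0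

lemma vertexLength_of_not_isVertex (hs : D.slices[k]? = some s) (hv : ¬ s.piece.IsVertex) :
    S.vertexLength k = 0 := by
  obtain ⟨hk, rfl⟩ := List.getElem?_eq_some_iff.1 hs
  exact dif_neg fun h => hv h.2

/-- The canonical order of the bands is from left to right at both kinds of vertex, so the line
through the legs shows `P(S, v)` in one-line notation. -/
lemma segment_leg (v : Vertex D) :
    S.segment a (if D.slices[v.1].piece = .source then (v.1 : ℕ) else v.1 + 1)
      D.slices[v.1].left.length n = List.ofFn (S.perm v) := by
  refine List.ext_getElem (by simp [segment]) fun i h _ => ?_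
  have hi : i < n := by simpa [segment] using h
  have hl : S.labelAt a (leg D v ⟨i, hi⟩) = S.perm v ⟨i, hi⟩ := dif_pos (leg_mem D v ⟨i, hi⟩)
  simpa [segment, leg] using hl

lemma exists_perm_source (hs : D.slices[k]? = some s) (hp : s.piece = .source) :
    ∃ σ : Equiv.Perm (Fin n), S.vertexLength k = permLength σ ∧
      S.segment a k s.left.length n = List.ofFn σ := by
  obtain ⟨hk, rfl⟩ := List.getElem?_eq_some_iff.1 hs
  refine ⟨_, dif_pos ⟨hk, Or.inl hp⟩, ?_⟩
  rw [← segment_leg (a := a)]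
  simp [hp]

lemma exists_perm_sink (hs : D.slices[k]? = some s) (hp : s.piece = .sink) :
    ∃ σ : Equiv.Perm (Fin n), S.vertexLength k = permLength σ ∧
      S.segment a (k + 1) s.left.length n = List.ofFn σ := by
  obtain ⟨hk, rfl⟩ := List.getElem?_eq_some_iff.1 hs
  refine ⟨_, dif_pos ⟨hk, Or.inr hp⟩, ?_⟩
  rw [← segment_leg (a := a)]
  simp [hp]

lemma inversions_word_pair {l r : List Strand} (h0 : D.slices[k]? = some ⟨l, .source, r⟩)
    (h1 : D.slices[k + 1]? = some ⟨l, .sink, r⟩) :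
    (inversions (S.word a k) + S.vertexLength k) % 2 =
      (inversions (S.word a (k + 1 + 1)) + S.vertexLength (k + 1)) % 2 := by
  obtain ⟨σ, hσ, hσ'⟩ := exists_perm_source (S := S) (a := a) h0 rfl
  obtain ⟨τ, hτ, hτ'⟩ := exists_perm_sink (S := S) (a := a) h1 rfl
  -- The line between the two vertices is read once from below and once from above. Equal lengths
  -- then identify the outer segments, so its own inversions never enter.
  have e := (word_succ_eq (S := S) (a := a) h0).symm.trans (word_eq h1)
  have e1 := word_eq (S := S) (a := a) h0
  have e2 := word_succ_eq (S := S) (a := a) h1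
  simp only [Piece.dom, Piece.cod, List.length_replicate, List.length_nil] at e e1 e2 hσ' hτ'
  have hA := List.append_inj e (by simp [segment])
  have hA' := List.append_inj hA.1 (by simp [segment])
  rw [hσ'] at e1
  rw [hτ', ← hA'.1, ← hA.2] at e2
  rw [e1, e2, hσ, hτ]
  exact inversions_replace_ofFn σ τ _ _

/-- Telescoping over a suffix `E`: the pairing is peeled off from the head, while the state stays on
the whole diagram and `X` records the slices already passed. -/
lemma sum_vertexLength_suffix {E : List Slice} (hE : SourceSinkPaired E)
    (hc : ∀ s ∈ E, ¬ s.piece.IsCrossing) (X : List Slice) (hD : D.slices = X ++ E) :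
    (∑ j ∈ Finset.range E.length, S.vertexLength (X.length + j)) % 2 =
      (inversions (S.word a X.length) + inversions (S.word a D.slices.length)) % 2 := by
  induction hE generalizing X with
  | nil => simp [hD]; omega
  | cons s E hs _ ih =>
    have h := ih (fun t ht => hc t (by simp [ht])) (X ++ [s]) (by simp [hD])
    have hk : D.slices[X.length]? = some s := by simp [hD]
    have h1 := inversions_word_succ (S := S) (a := a) hk hs (hc s (by simp))
    rw [List.length_cons, Finset.sum_range_succ', add_zero, vertexLength_of_not_isVertex hk hs]
    simp only [List.length_append, List.length_singleton, add_assoc, add_comm 1] at h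
    omega
  | pair l r E _ ih =>
    have h := ih (fun t ht => hc t (by simp [ht])) (X ++ [⟨l, .source, r⟩, ⟨l, .sink, r⟩])
      (by simp [hD])
    have h1 := inversions_word_pair (S := S) (a := a) (k := X.length) (l := l) (r := r)
      (by simp [hD]) (by simp [hD])
    rw [List.length_cons, List.length_cons, Finset.sum_range_succ', Finset.sum_range_succ',
      add_zero, zero_add]
    have e : ∀ j, X.length + (j + 1 + 1) = (X ++ [(⟨l, .source, r⟩ : Slice), ⟨l, .sink, r⟩]).length + j := by
      intro j; simp; omega
    simp only [e]
    have e2 : (X ++ [(⟨l, .source, r⟩ : Slice), ⟨l, .sink, r⟩]).length = X.length + 1 + 1 := by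
      simp
    rw [e2] at h ⊢
    omega

variable (S) in
-- Slices without a vertex count as `0`, which brings the sum into the form needed for telescoping.
lemma sum_permLength : ∑ v : Vertex D, permLength (S.perm v) =
    ∑ k ∈ Finset.range D.slices.length, S.vertexLength k := by
  have h (k : Fin D.slices.length) (hk : S.vertexLength k ≠ 0) : D.slices[k].piece.IsVertex := by
    by_contra hv
    exact hk (vertexLength_of_not_isVertex (List.getElem?_eq_getElem k.2) hv)
  rw [Finset.sum_range, ← Finset.sum_filter_of_ne fun k _ => h k,
    Finset.sum_subtype (p := fun k : Fin D.slices.length => D.slices[k].piece.IsVertex) _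
      (by simp)]
  refine Finset.sum_congr rfl fun v _ => ?_
  have hv : ∃ hk : v.1.1 < D.slices.length, D.slices[v.1.1].piece.IsVertex := ⟨v.1.2, v.2⟩
  rw [vertexLength, dif_pos hv]

lemma even_sum_permLength (S : State D) (a : Fin n) (h : SourceSinkPaired D.slices)
    (hD : D.IsPlanar) : Even (∑ v : Vertex D, permLength (S.perm v)) := by
  have e := sum_vertexLength_suffix (S := S) (a := a) h hD [] rfl
  simp only [List.length_nil, zero_add] at e
  have h1 : level n D.slices D.slices.length = [] := by simp [level]
  rw [Nat.even_iff, sum_permLength, e]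
  simp [word, D.level_zero, h1, segment, inversions]

end State
end Web

theorem mainTheorem12 (n : ℕ) (hn : 2 ≤ n) (L Γ : Web.WebDiagram n) (hL : L.IsLink)
    (hΓ : Web.IsLeaf L Γ) :
    (∀ S : Web.State Γ, Even (∑ v : Web.Vertex Γ, Web.permLength (S.perm v))) ∧
      ∃ f : LaurentPolynomial ℤ, Web.bracket Γ = Web.inclusion n f ∧ ∀ k : ℤ, 0 ≤ f.coeff k := by
  have h := hΓ.sourceSinkPaired hL
  -- The label `0` is only the default value for points outside the diagram.
  exact ⟨fun S => S.even_sum_permLength ⟨0, by omega⟩ h hΓ.2,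
    Web.exists_inclusion_of_mem_posCone (Web.bracket_mem_posCone (by omega) h hΓ.2)⟩
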